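/- Let $X$ be a two-dimensional real Banach space. For a compact Hausdorff space $K$, let $C(K)$ be the Banach space of continuous real-valued functions on $K$ with the maximum norm. A linear isometry (into) $T\colon X\to C(K)$ is called a U-embedding if every $x^*\in X^*$ with $\|x^*\|=1$ has a unique Hahn--Banach extension through $T$, that is, if there is exactly one $y^*\in C(K)^*$ with $y^*\circ T=x^*$ and $\|y^*\|=\|x^*\|$. Then there exist a compact Hausdorff space $K$ and a U-embedding $T\colon X\to C(K)$ if and only if $X$ is not Gâteaux smooth, i.e. if and only if the norm of $X$ fails to be Gâteaux differentiable at some nonzero point of $X$. -/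

import Mathlib

universe u v

/-- For a linear isometry `T : X → Y` (into), `g ∈ Y*` is a Hahn--Banach extension of `f ∈ X*`
through `T` if `T* g = f` (that is, `g ∘ T = f`) and `‖g‖ = ‖f‖`. -/
def IsHahnBanachExtension {X Y : Type*} [NormedAddCommGroup X] [NormedSpace ℝ X]
    [NormedAddCommGroup Y] [NormedSpace ℝ Y] (T : X →ₗᵢ[ℝ] Y)
    (f : StrongDual ℝ X) (g : StrongDual ℝ Y) : Prop :=
  g.comp T.toContinuousLinearMap = f ∧ ‖g‖ = ‖f‖

/-- A linear isometry `T : X → Y` (into) is a U-embedding if every norm-one functional on `X`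
has exactly one Hahn--Banach extension through `T`. -/
def IsUEmbedding {X Y : Type*} [NormedAddCommGroup X] [NormedSpace ℝ X]
    [NormedAddCommGroup Y] [NormedSpace ℝ Y] (T : X →ₗᵢ[ℝ] Y) : Prop :=
  ∀ f : StrongDual ℝ X, ‖f‖ = 1 → ∃! g : StrongDual ℝ Y, IsHahnBanachExtension T f g

/-- A real function `φ` on a normed space is Gâteaux differentiable at `x` if there is a continuous
linear functional whose value at each `v` is the (two-sided) derivative of `φ` at `x` in the
direction `v`. -/
def GateauxDifferentiableAt {X : Type*} [NormedAddCommGroup X] [NormedSpace ℝ X]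
    (φ : X → ℝ) (x : X) : Prop :=
  ∃ L : StrongDual ℝ X, ∀ v : X, HasLineDerivAt ℝ φ (L v) x v

/-- A normed space is Gâteaux smooth if its norm is Gâteaux differentiable at every nonzero
point. -/
def IsGateauxSmooth (X : Type*) [NormedAddCommGroup X] [NormedSpace ℝ X] : Prop :=
  ∀ x : X, x ≠ 0 → GateauxDifferentiableAt (fun y : X => ‖y‖) x

/-!
If `X` is smooth and `T` embeds it into `C(K)`, every norm-one functional has the form `±T* δ_k`,
so the dual unit sphere is covered by the compact set `P` of all `T* δ_k` and by `-P`. For a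
U-embedding these are disjoint on the sphere, because `T* δ_k = -T* δ_l` would give the functional
`T* δ_k` the two extensions `δ_k` and `-δ_l`. The sphere being connected, this is absurd.

If the norm is not differentiable at `x`, the functionals norming `x` form a flat segment of the
dual sphere, and some line `{f | f u = 0}` of the dual plane cuts the sphere only inside this
segment and its opposite, away from the extreme points of the dual ball. Let `K` be the set of
extreme points `e` with `e u ≥ 0`, which is compact in dimension two, and `T y = (e ↦ e y)`. For a
unit vector `y`, the set `{|T y| = 1}` has at most two points, so functions on it are interpolated
by `T X`. An extension of a functional norming `y` only sees this set, hence is unique.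
-/

open Metric Set Filter Topology

section SupportFunctionals

variable {X : Type*} [NormedAddCommGroup X] [NormedSpace ℝ X]

theorem apply_le_norm_of_norm_le_one {f : StrongDual ℝ X} (hf : ‖f‖ ≤ 1) (x : X) : f x ≤ ‖x‖ :=
  (le_abs_self _).trans (by simpa using f.le_of_opNorm_le hf x)

/-- The functionals of the dual unit ball that norm `x`, that is, the subdifferential of the norm
at `x`. At `x = 0` this is the whole ball. -/
def supportFunctionals (x : X) : Set (StrongDual ℝ X) :=
  {f | ‖f‖ ≤ 1 ∧ f x = ‖x‖}

theorem supportFunctionals_nonempty (x : X) : (supportFunctionals x).Nonempty :=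
  exists_dual_vector'' ℝ x

theorem eq_of_hasLineDerivAt_norm {x : X} {L f : StrongDual ℝ X}
    (hL : ∀ v : X, HasLineDerivAt ℝ (fun y : X ↦ ‖y‖) (L v) x v)
    (hf : f ∈ supportFunctionals x) : f = L := by
  ext v
  have hf_deriv : HasLineDerivAt ℝ f (f v) x v := f.hasFDerivAt.hasLineDerivAt v
  have hderiv : HasDerivAt (fun t : ℝ ↦ ‖x + t • v‖ - f (x + t • v)) (L v - f v) 0 :=
    HasDerivAt.sub (hL v) hf_deriv
  have hmin : IsLocalMin (fun t : ℝ ↦ ‖x + t • v‖ - f (x + t • v)) 0 :=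
    Eventually.of_forall fun t ↦ by
      simpa [hf.2] using apply_le_norm_of_norm_le_one hf.1 (x + t • v)
  exact (sub_eq_zero.1 (hmin.hasDerivAt_eq_zero hderiv)).symm

theorem abs_slope_norm_sub_le {x v : X} {t : ℝ} (ht : t ≠ 0) {f g : StrongDual ℝ X}
    (hf : f ∈ supportFunctionals x) (hg : g ∈ supportFunctionals (x + t • v)) :
    |t⁻¹ * (‖x + t • v‖ - ‖x‖) - f v| ≤ |g v - f v| := by
  have hlower := apply_le_norm_of_norm_le_one hf.1 (x + t • v)
  have hupper := apply_le_norm_of_norm_le_one hg.1 x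
  have hnorm := hg.2
  simp only [map_add, map_smul, smul_eq_mul, hf.2] at hlower hnorm
  have hslope : t⁻¹ * (‖x + t • v‖ - ‖x‖) - f v = t⁻¹ * (‖x + t • v‖ - ‖x‖ - t * f v) := by
    field_simp
  have hdiff : g v - f v = t⁻¹ * (t * g v - t * f v) := by field_simp
  rw [hslope, hdiff, abs_mul, abs_mul]
  gcongr ?_ * ?_
  exact abs_le_abs_of_nonneg (by linarith) (by linarith)

/-- Banach–Alaoglu: a weak-* cluster point of support functionals at points converging to `x`
supports `x`. -/
theorem tendsto_apply_of_mem_supportFunctionals {ι : Type*} {l : Filter ι} {x : X}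
    (hx : (supportFunctionals x).Subsingleton) {f : StrongDual ℝ X}
    (hf : f ∈ supportFunctionals x) {y : ι → X} (hy : Tendsto y l (𝓝 x))
    {F : ι → StrongDual ℝ X} (hF : ∀ i, F i ∈ supportFunctionals (y i)) (v : X) :
    Tendsto (fun i ↦ F i v) l (𝓝 (f v)) := by
  suffices hweak : Tendsto (fun i ↦ (F i).toWeakDual) l (𝓝 f.toWeakDual) from
    ((WeakDual.eval_continuous v).tendsto _).comp hweak
  refine (WeakDual.isCompact_closedBall (𝕜 := ℝ) (0 : StrongDual ℝ X) 1)
    |>.tendsto_nhds_of_unique_mapClusterPt ?_ fun g hg hcluster ↦ ?_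
  · exact Eventually.of_forall fun i ↦ mem_closedBall_zero_iff.2 (hF i).1
  obtain ⟨U, hU, hUg⟩ := mapClusterPt_iff_ultrafilter.1 hcluster
  have hyU : Tendsto y U (𝓝 x) := hy.mono_left hU
  have hFx : Tendsto (fun i ↦ F i x) U (𝓝 (g x)) :=
    ((WeakDual.eval_continuous x).tendsto _).comp hUg
  have hFyx : Tendsto (fun i ↦ F i (y i - x)) U (𝓝 0) := by
    refine squeeze_zero_norm (fun i ↦ ?_) (tendsto_iff_norm_sub_tendsto_zero.1 hyU)
    simpa using (F i).le_of_opNorm_le (hF i).1 (y i - x)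
  have hFy : Tendsto (fun i ↦ ‖y i‖) U (𝓝 (g x)) := by
    simpa [(hF _).2] using hFx.add hFyx
  have hgx : g x = ‖x‖ := tendsto_nhds_unique hFy hyU.norm
  exact congrArg StrongDual.toWeakDual <|
    hx (x := WeakDual.toStrongDual g) ⟨mem_closedBall_zero_iff.1 hg, hgx⟩ hf

theorem gateauxDifferentiableAt_norm_iff {x : X} :
    GateauxDifferentiableAt (fun y : X ↦ ‖y‖) x ↔ (supportFunctionals x).Subsingleton := by
  constructor
  · rintro ⟨L, hL⟩ f hf g hg
    rw [eq_of_hasLineDerivAt_norm hL hf, eq_of_hasLineDerivAt_norm hL hg]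
  intro hx
  obtain ⟨f, hf⟩ := supportFunctionals_nonempty x
  refine ⟨f, fun v ↦ hasLineDerivAt_iff_tendsto_slope_zero.2 ?_⟩
  choose F hF using fun t : ℝ ↦ supportFunctionals_nonempty (x + t • v)
  have hline : Tendsto (fun t : ℝ ↦ x + t • v) (𝓝[≠] 0) (𝓝 x) :=
    Continuous.tendsto' (by fun_prop) 0 x (by simp) |>.mono_left nhdsWithin_le_nhds
  have hFv := tendsto_apply_of_mem_supportFunctionals hx hf hline hF v
  rw [tendsto_iff_norm_sub_tendsto_zero] at hFv ⊢
  refine squeeze_zero' (Eventually.of_forall fun _ ↦ norm_nonneg _) ?_ hFv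
  filter_upwards [self_mem_nhdsWithin] with t ht
  exact abs_slope_norm_sub_le ht hf (hF t)

theorem isGateauxSmooth_iff :
    IsGateauxSmooth X ↔ ∀ x : X, x ≠ 0 → (supportFunctionals x).Subsingleton := by
  simp only [IsGateauxSmooth, gateauxDifferentiableAt_norm_iff]

end SupportFunctionals

section Plane

theorem collinear_setOf_apply_eq {k V : Type*} [Field k] [AddCommGroup V] [Module k V]
    (hV : Module.finrank k V = 2) {φ : Module.Dual k V} (hφ : φ ≠ 0) (c : k) :
    Collinear k {v | φ v = c} := by
  have : FiniteDimensional k V := Module.finite_of_finrank_eq_succ hV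
  have hspan : vectorSpan k {v | φ v = c} ≤ LinearMap.ker φ := by
    rw [vectorSpan, Submodule.span_le]
    rintro _ ⟨v, rfl : φ v = c, w, hw, rfl⟩
    simpa [sub_eq_zero] using hw.symm
  have hker := Module.Dual.finrank_ker_add_one_of_ne_zero hφ
  exact collinear_iff_finrank_le_one.2 ((Submodule.finrank_mono hspan).trans (by omega))

theorem linearIndependent_pair_of_apply_eq {k V : Type*} [Field k] [AddCommGroup V] [Module k V]
    {φ : Module.Dual k V} {v w : V} (hv : φ v ≠ 0) (hvw : φ v = φ w) (hne : v ≠ w) :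
    LinearIndependent k ![v, w] := by
  refine (LinearIndependent.pair_iff' fun h ↦ hv (by simp [h])).2 fun a ha ↦ hne ?_
  have ha_one : a = 1 := by
    rw [← ha, map_smul, smul_eq_mul] at hvw
    exact (right_eq_mul₀ hv).1 hvw
  rw [← ha, ha_one, one_smul]

theorem exists_eq_smul_add_smul {k V : Type*} [Field k] [AddCommGroup V] [Module k V]
    (hV : Module.finrank k V = 2) {v w : V} (hvw : LinearIndependent k ![v, w]) (z : V) :
    ∃ a b : k, a • v + b • w = z := by
  have : FiniteDimensional k V := Module.finite_of_finrank_eq_succ hV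
  have hspan := hvw.span_eq_top_of_card_eq_finrank' (by simp [hV])
  rw [Matrix.range_cons_cons_empty] at hspan
  exact Submodule.mem_span_pair.1 (hspan ▸ Submodule.mem_top)

theorem isOpen_setOf_pos_smul_add_pos_smul {V : Type*} [AddCommGroup V] [Module ℝ V]
    [TopologicalSpace V] [IsTopologicalAddGroup V] [ContinuousSMul ℝ V] [T2Space V]
    (hV : Module.finrank ℝ V = 2) {v w : V} (hvw : LinearIndependent ℝ ![v, w]) :
    IsOpen {z | ∃ a > (0 : ℝ), ∃ b > (0 : ℝ), a • v + b • w = z} := by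
  have : FiniteDimensional ℝ V := Module.finite_of_finrank_eq_succ hV
  let B : Module.Basis (Fin 2) ℝ V := basisOfLinearIndependentOfCardEqFinrank hvw (by simp [hV])
  have hB (z : V) : B.coord 0 z • v + B.coord 1 z • w = z := by
    simpa [Fin.sum_univ_two, B] using B.sum_repr z
  have hcoord (a b : ℝ) : B.coord 0 (a • v + b • w) = a ∧ B.coord 1 (a • v + b • w) = b := by
    have hv : B 0 = v := by simp [B]
    have hw : B 1 = w := by simp [B]
    simp [← hv, ← hw]
  have hcone : {z | ∃ a > (0 : ℝ), ∃ b > (0 : ℝ), a • v + b • w = z} =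
      {z | 0 < B.coord 0 z} ∩ {z | 0 < B.coord 1 z} := by
    ext z
    constructor
    · rintro ⟨a, ha, b, hb, rfl⟩
      exact ⟨by simpa only [mem_ofPred_eq, hcoord], by simpa only [mem_ofPred_eq, hcoord]⟩
    · exact fun ⟨ha, hb⟩ ↦ ⟨_, ha, _, hb, hB z⟩
  rw [hcone]
  exact (isOpen_lt continuous_const (B.coord 0).continuous_of_finiteDimensional).inter
    (isOpen_lt continuous_const (B.coord 1).continuous_of_finiteDimensional)

end Plane

section ExtremePoints

theorem eq_of_collinear_of_mem_extremePoints {k V : Type*} [Field k] [LinearOrder k]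
    [IsStrictOrderedRing k] [AddCommGroup V] [Module k V] {A : Set V} {a b c : V}
    (h : Collinear k {a, b, c}) (ha : a ∈ A.extremePoints k) (hb : b ∈ A.extremePoints k)
    (hc : c ∈ A.extremePoints k) : a = b ∨ b = c ∨ c = a := by
  have endpoint {p q r : V} (hp : p ∈ A.extremePoints k) (hq : q ∈ A.extremePoints k)
      (hr : r ∈ A.extremePoints k) (hpqr : Wbtw k p q r) : p = q ∨ r = q :=
    (mem_extremePoints_iff_forall_segment.1 hq).2 p hp.1 r hr.1 (mem_segment_iff_wbtw.2 hpqr)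
  rcases h.wbtw_or_wbtw_or_wbtw with h | h | h
  · grind [endpoint ha hb hc h]
  · grind [endpoint hb hc ha h]
  · grind [endpoint hc ha hb h]

variable {E : Type*} [NormedAddCommGroup E] [NormedSpace ℝ E]

/-- The set `ext B_E` of extreme points of the closed unit ball. -/
def unitBallExtremePoints (E : Type*) [NormedAddCommGroup E] [NormedSpace ℝ E] : Set E :=
  (closedBall (0 : E) 1).extremePoints ℝ

theorem norm_eq_one_of_mem_unitBallExtremePoints [Nontrivial E] {e : E}
    (he : e ∈ unitBallExtremePoints E) : ‖e‖ = 1 :=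
  mem_sphere_zero_iff_norm.1 (extremePoints_closedBall_subset_sphere he)

theorem neg_mem_unitBallExtremePoints {e : E} (he : e ∈ unitBallExtremePoints E) :
    -e ∈ unitBallExtremePoints E := by
  have himage := image_extremePoints (𝕜 := ℝ) (LinearEquiv.neg ℝ) (closedBall (0 : E) 1)
  have hball : LinearEquiv.neg ℝ '' closedBall (0 : E) 1 = closedBall 0 1 := by simp
  rw [unitBallExtremePoints, ← hball, ← himage]
  exact mem_image_of_mem _ he

theorem exists_mem_unitBallExtremePoints_apply_eq_norm [FiniteDimensional ℝ E]
    (φ : StrongDual ℝ E) : ∃ e ∈ unitBallExtremePoints E, φ e = ‖φ‖ := by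
  have hcompact := isCompact_closedBall (0 : E) 1
  obtain ⟨p, hp, hpmax⟩ := hcompact.exists_isMaxOn ⟨0, by simp⟩ φ.continuous.continuousOn
  have hface : IsExposed ℝ (closedBall (0 : E) 1) (φ.toExposed (closedBall 0 1)) :=
    ContinuousLinearMap.toExposed.isExposed
  obtain ⟨e, he⟩ := (hface.isCompact hcompact).extremePoints_nonempty ⟨p, hp, fun _ hz ↦ hpmax hz⟩
  obtain ⟨heball, hemax⟩ := extremePoints_subset he
  refine ⟨e, hface.isExtreme.extremePoints_subset_extremePoints he, le_antisymm ?_ ?_⟩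
  · exact (le_abs_self _).trans (φ.unit_le_opNorm e (mem_closedBall_zero_iff.1 heball))
  · refine φ.opNorm_le_of_unit_norm (by simpa using hemax 0 (by simp)) fun z hz ↦ abs_le'.2 ?_
    exact ⟨hemax z (by simp [hz]), by simpa using hemax (-z) (by simp [hz])⟩

theorem smul_add_smul_notMem_unitBallExtremePoints {φ : StrongDual ℝ E} (hφ : φ ≠ 0) {c d : E}
    (hc : ‖c‖ ≤ 1) (hd : ‖d‖ ≤ 1) (hφc : φ c = ‖φ‖) (hφd : φ d = ‖φ‖) (hne : c ≠ d) {a b : ℝ}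
    (ha : 0 < a) (hb : 0 < b) : a • c + b • d ∉ unitBallExtremePoints E := by
  intro he
  have : Nontrivial E := ⟨c, d, hne⟩
  have hnorm := norm_eq_one_of_mem_unitBallExtremePoints he
  have hab : a + b = 1 := by
    refine le_antisymm ?_ ?_
    · have hle := φ.le_opNorm (a • c + b • d)
      rw [map_add, map_smul, map_smul, hφc, hφd, ← add_smul, norm_smul, norm_norm, hnorm,
        mul_one, mul_le_iff_le_one_left (norm_pos_iff.2 hφ)] at hle
      exact (le_abs_self _).trans hle
    · calc 1 = ‖a • c + b • d‖ := hnorm.symm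
        _ ≤ a * ‖c‖ + b * ‖d‖ := by
          grw [norm_add_le, norm_smul_of_nonneg ha.le, norm_smul_of_nonneg hb.le]
        _ ≤ a + b := by nlinarith
  obtain ⟨hce, hde⟩ := (mem_extremePoints.1 he).2 c (by simpa) d (by simpa) ⟨a, b, ha, hb, hab, rfl⟩
  exact hne (hce.trans hde.symm)

/-- If `f` is a norm-one point inside a segment `[c, d]` of the ball, the open cone spanned by `c`
and `d` is a neighbourhood of `f` free of extreme points. -/
theorem isClosed_unitBallExtremePoints (hE : Module.finrank ℝ E = 2) :
    IsClosed (unitBallExtremePoints E) := by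
  have : Nontrivial E := Module.nontrivial_of_finrank_eq_succ hE
  rw [← isOpen_compl_iff, isOpen_iff_mem_nhds]
  intro f hf
  by_cases hnorm : ‖f‖ = 1
  swap
  · filter_upwards [continuous_norm.continuousAt.eventually_ne hnorm] with e he_norm he
    exact he_norm (norm_eq_one_of_mem_unitBallExtremePoints he)
  obtain ⟨c, hc, d, hd, ⟨a, b, ha, hb, hab, hf_eq⟩, hcf⟩ :
      ∃ c ∈ closedBall (0 : E) 1, ∃ d ∈ closedBall (0 : E) 1, f ∈ openSegment ℝ c d ∧ c ≠ f := by
    simpa [unitBallExtremePoints, mem_extremePoints_iff_left, hnorm] using hf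
  rw [mem_closedBall_zero_iff] at hc hd
  obtain ⟨φ, hφ, hφf⟩ := exists_dual_vector' ℝ f
  have hφc := apply_le_norm_of_norm_le_one hφ.le c
  have hφd := apply_le_norm_of_norm_le_one hφ.le d
  have hφ_eq : a * φ c + b * φ d = 1 := by
    simpa [hnorm] using (congrArg φ hf_eq).trans hφf
  replace hφc : φ c = 1 := by nlinarith
  replace hφd : φ d = 1 := by nlinarith
  have hne : c ≠ d := by
    rintro rfl
    exact hcf (by rw [← hf_eq, ← add_smul, hab, one_smul])
  have hli : LinearIndependent ℝ ![c, d] :=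
    linearIndependent_pair_of_apply_eq (φ := φ.toLinearMap) (by simp [hφc]) (by simp [hφc, hφd]) hne
  filter_upwards [(isOpen_setOf_pos_smul_add_pos_smul hE hli).mem_nhds ⟨a, ha, b, hb, hf_eq⟩]
  rintro _ ⟨s, hs, t, ht, rfl⟩
  exact smul_add_smul_notMem_unitBallExtremePoints (norm_ne_zero_iff.1 (by simp [hφ])) hc hd
    (hφc.trans hφ.symm) (hφd.trans hφ.symm) hne hs ht

end ExtremePoints

section Interpolation

theorem apply_eq_zero_of_apply_eq_one {K : Type*} [TopologicalSpace K] [CompactSpace K]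
    {g : StrongDual ℝ C(K, ℝ)} (hg : ‖g‖ ≤ 1) {u h : C(K, ℝ)} (hu : ‖u‖ ≤ 1) (hgu : g u = 1)
    (hh : ∀ k, |u k| = 1 → h k = 0) : g h = 0 := by
  suffices hnonpos : ∀ h : C(K, ℝ), (∀ k, |u k| = 1 → h k = 0) → g h ≤ 0 from
    le_antisymm (hnonpos h hh) <| neg_nonpos.1 <| by
      simpa using hnonpos (-h) fun k hk ↦ by simp [hh k hk]
  intro h hh
  by_contra! hgh
  have hexists {t : ℝ} (ht : 0 < t) : ∃ k, 1 + t * g h ≤ |u k| + t * |h k| := by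
    by_contra! hlt
    have hnorm : ‖u + t • h‖ < 1 + t * g h :=
      (ContinuousMap.norm_lt_iff _ (by positivity)).2 fun k ↦
        (norm_add_le _ _).trans_lt (by simpa [abs_mul, abs_of_pos ht] using hlt k)
    exact (apply_le_norm_of_norm_le_one hg (u + t • h)).not_gt (by simpa [hgu] using hnorm)
  have hu_le (k : K) : |u k| ≤ 1 := (u.norm_coe_le_norm k).trans hu
  have hcompact : IsCompact {k | g h ≤ |h k|} :=
    (isClosed_le continuous_const h.continuous.abs).isCompact
  have hlarge {t : ℝ} (ht : 0 < t) : ∃ k ∈ {k | g h ≤ |h k|}, 1 - t * ‖h‖ ≤ |u k| := by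
    obtain ⟨k, hk⟩ := hexists ht
    refine ⟨k, le_of_mul_le_mul_left ?_ ht, ?_⟩
    · linarith [hu_le k]
    · nlinarith [h.norm_coe_le_norm k, Real.norm_eq_abs (h k)]
  obtain ⟨k, hk, hmax⟩ := hcompact.exists_isMaxOn (let ⟨k, hk, _⟩ := hlarge one_pos; ⟨k, hk⟩)
    u.continuous.abs.continuousOn
  have hlim : Tendsto (fun t ↦ 1 - t * ‖h‖) (𝓝[>] 0) (𝓝 1) :=
    (Continuous.tendsto' (by fun_prop) 0 1 (by simp)).mono_left nhdsWithin_le_nhds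
  have huk : 1 ≤ |u k| := le_of_tendsto hlim <| by
    filter_upwards [self_mem_nhdsWithin] with t ht
    obtain ⟨l, hl, hle⟩ := hlarge ht
    exact hle.trans (hmax hl)
  have hhk : h k = 0 := hh k ((hu_le k).antisymm huk)
  exact hgh.not_ge (by simpa [hhk] using hk)

end Interpolation

section UEmbeddings

variable {X Y : Type*} [NormedAddCommGroup X] [NormedSpace ℝ X] [NormedAddCommGroup Y]
  [NormedSpace ℝ Y]

theorem norm_comp_linearIsometry_le (g : StrongDual ℝ Y) (T : X →ₗᵢ[ℝ] Y) :
    ‖g.comp T.toContinuousLinearMap‖ ≤ ‖g‖ := by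
  grw [ContinuousLinearMap.opNorm_comp_le, LinearIsometry.norm_toContinuousLinearMap_le, mul_one]

theorem exists_isHahnBanachExtension (T : X →ₗᵢ[ℝ] Y) (f : StrongDual ℝ X) :
    ∃ g : StrongDual ℝ Y, IsHahnBanachExtension T f g := by
  let e := T.equivRange
  obtain ⟨g, hg, hnorm⟩ := exists_extension_norm_eq T.range
    (f.comp e.symm.toLinearIsometry.toContinuousLinearMap)
  have hgT : g.comp T.toContinuousLinearMap = f := by
    ext x
    simpa [e] using hg (e x)
  refine ⟨g, hgT, le_antisymm ?_ ?_⟩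
  · exact hnorm.trans_le (norm_comp_linearIsometry_le f e.symm.toLinearIsometry)
  · exact hgT ▸ norm_comp_linearIsometry_le g T

theorem exists_norm_eq_one_apply_eq_one [FiniteDimensional ℝ X] {f : StrongDual ℝ X}
    (hf : ‖f‖ = 1) : ∃ x : X, ‖x‖ = 1 ∧ f x = 1 := by
  obtain ⟨x, hx, hfx⟩ := exists_mem_unitBallExtremePoints_apply_eq_norm f
  rw [hf] at hfx
  have : Nontrivial X := ⟨x, 0, fun h ↦ by simp [h] at hfx⟩
  exact ⟨x, norm_eq_one_of_mem_unitBallExtremePoints hx, hfx⟩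

theorem isUEmbedding_of_interpolation [FiniteDimensional ℝ X] {K : Type*} [TopologicalSpace K]
    [CompactSpace K] {T : X →ₗᵢ[ℝ] C(K, ℝ)}
    (hT : ∀ x : X, ‖x‖ = 1 → ∀ h : C(K, ℝ), ∃ y : X, ∀ k, |T x k| = 1 → T y k = h k) :
    IsUEmbedding T := by
  intro f hf
  obtain ⟨x, hx, hfx⟩ := exists_norm_eq_one_apply_eq_one hf
  refine existsUnique_of_exists_of_unique (exists_isHahnBanachExtension T f) ?_
  intro g₁ g₂ hg₁ hg₂
  ext h
  obtain ⟨y, hy⟩ := hT x hx h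
  have apply_eq {g : StrongDual ℝ C(K, ℝ)} (hg : IsHahnBanachExtension T f g) : g h = f y := by
    have hgT (z : X) : g (T z) = f z := congrArg (· z) hg.1
    have hzero : g (h - T y) = 0 :=
      apply_eq_zero_of_apply_eq_one (hg.2.trans hf).le ((T.norm_map x).trans hx).le
        ((hgT x).trans hfx) fun k hk ↦ by simp [hy k hk]
    rwa [map_sub, hgT, sub_eq_zero] at hzero
  rw [apply_eq hg₁, apply_eq hg₂]

end UEmbeddings

section PointEvaluations

variable {X K : Type*} [NormedAddCommGroup X] [NormedSpace ℝ X] [TopologicalSpace K]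
  [CompactSpace K] {T : X →ₗᵢ[ℝ] C(K, ℝ)} {k l : K}

/-- The functional `T* δ_k`, where `δ_k` is evaluation at the point `k` of `K`. -/
noncomputable def pointEval (T : X →ₗᵢ[ℝ] C(K, ℝ)) (k : K) : StrongDual ℝ X :=
  (ContinuousMap.evalCLM ℝ k).comp T.toContinuousLinearMap

theorem norm_evalCLM_le_one (k : K) :
    ‖(ContinuousMap.evalCLM ℝ k : StrongDual ℝ C(K, ℝ))‖ ≤ 1 :=
  ContinuousLinearMap.opNorm_le_bound _ zero_le_one fun h ↦ by simpa using h.norm_coe_le_norm k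

theorem norm_pointEval_le_one (k : K) : ‖pointEval T k‖ ≤ 1 :=
  (norm_comp_linearIsometry_le _ T).trans (norm_evalCLM_le_one k)

theorem continuous_pointEval [FiniteDimensional ℝ X] (T : X →ₗᵢ[ℝ] C(K, ℝ)) :
    Continuous (pointEval T) :=
  continuous_clm_apply.2 fun x ↦ (T x).continuous

theorem isHahnBanachExtension_evalCLM (hk : ‖pointEval T k‖ = 1) :
    IsHahnBanachExtension T (pointEval T k) (ContinuousMap.evalCLM ℝ k) :=
  ⟨rfl, ((norm_evalCLM_le_one k).trans hk.ge).antisymm (norm_comp_linearIsometry_le _ T)⟩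

theorem IsUEmbedding.pointEval_ne_neg_pointEval (hT : IsUEmbedding T)
    (hk : ‖pointEval T k‖ = 1) : pointEval T k ≠ -pointEval T l := by
  intro hkl
  obtain ⟨hcomp, hnorm⟩ :=
    isHahnBanachExtension_evalCLM (T := T) (k := l) (by rwa [hkl, norm_neg] at hk)
  have hneg : IsHahnBanachExtension T (pointEval T k) (-ContinuousMap.evalCLM ℝ l) :=
    ⟨by rw [ContinuousLinearMap.neg_comp, hcomp, hkl], by rw [norm_neg, hnorm, hkl, norm_neg]⟩
  have heval := (hT _ hk).unique (isHahnBanachExtension_evalCLM hk) hneg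
  have hone := congrArg (· (1 : C(K, ℝ))) heval
  norm_num at hone

theorem exists_abs_apply_eq_norm {h : C(K, ℝ)} (hh : h ≠ 0) : ∃ k, |h k| = ‖h‖ := by
  by_contra! hne
  refine lt_irrefl ‖h‖ ((h.norm_lt_iff (norm_pos_iff.2 hh)).2 fun k ↦ ?_)
  exact (h.norm_coe_le_norm k).lt_of_ne (hne k)

theorem exists_eq_pointEval_or_eq_neg_pointEval [FiniteDimensional ℝ X] (hX : IsGateauxSmooth X)
    (T : X →ₗᵢ[ℝ] C(K, ℝ)) {f : StrongDual ℝ X} (hf : ‖f‖ = 1) :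
    ∃ k, f = pointEval T k ∨ f = -pointEval T k := by
  obtain ⟨x, hx, hfx⟩ := exists_norm_eq_one_apply_eq_one hf
  have hx_ne : x ≠ 0 := norm_ne_zero_iff.1 (by simp [hx])
  have hf_mem : f ∈ supportFunctionals x := ⟨hf.le, hfx.trans hx.symm⟩
  have hunique := isGateauxSmooth_iff.1 hX x hx_ne
  obtain ⟨k, hk⟩ := exists_abs_apply_eq_norm ((T.map_ne hx_ne).trans_eq T.map_zero)
  rw [T.norm_map] at hk
  refine ⟨k, (abs_eq (norm_nonneg x)).1 hk |>.imp (fun hk ↦ ?_) fun hk ↦ ?_⟩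
  · exact hunique hf_mem ⟨norm_pointEval_le_one k, hk⟩
  · exact hunique hf_mem ⟨(norm_neg _).trans_le (norm_pointEval_le_one k), neg_eq_iff_eq_neg.2 hk⟩

theorem finrank_strongDual (X : Type*) [NormedAddCommGroup X] [NormedSpace ℝ X]
    [FiniteDimensional ℝ X] : Module.finrank ℝ (StrongDual ℝ X) = Module.finrank ℝ X :=
  LinearMap.toContinuousLinearMap.symm.finrank_eq.trans Subspace.dual_finrank_eq

theorem not_isUEmbedding_of_isGateauxSmooth (hdim : 1 < Module.finrank ℝ X)
    (hX : IsGateauxSmooth X) (T : X →ₗᵢ[ℝ] C(K, ℝ)) : ¬ IsUEmbedding T := by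
  intro hT
  have : FiniteDimensional ℝ X := Module.finite_of_finrank_pos (by omega)
  have : Nontrivial X := Module.nontrivial_of_finrank_pos (R := ℝ) (by omega)
  have hclosed : IsClosed (range (pointEval T)) :=
    (isCompact_range (continuous_pointEval T)).isClosed
  have hcover : sphere 0 1 ⊆ range (pointEval T) ∪ Neg.neg ⁻¹' range (pointEval T) := by
    intro f hf
    obtain ⟨k, hk | hk⟩ :=
      exists_eq_pointEval_or_eq_neg_pointEval hX T (mem_sphere_zero_iff_norm.1 hf)
    · exact .inl ⟨k, hk.symm⟩
    · exact .inr ⟨k, by simp [hk]⟩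
  have hdisj {f : StrongDual ℝ X} (hf : ‖f‖ = 1) (hpos : f ∈ range (pointEval T)) :
      -f ∉ range (pointEval T) := by
    obtain ⟨k, rfl⟩ := hpos
    rintro ⟨l, hl⟩
    exact hT.pointEval_ne_neg_pointEval hf (neg_eq_iff_eq_neg.1 hl.symm)
  have hrank : 1 < Module.rank ℝ (StrongDual ℝ X) := by
    rw [← Module.finrank_eq_rank, finrank_strongDual]
    exact_mod_cast hdim
  obtain ⟨f, hf⟩ := exists_norm_eq (StrongDual ℝ X) zero_le_one
  rcases isPreconnected_iff_subset_of_disjoint_closed.1 (isPreconnected_sphere hrank 0 1) _ _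
    hclosed (hclosed.preimage continuous_neg) hcover (by grind [mem_sphere_zero_iff_norm])
    with hsub | hsub
  · exact hdisj hf (hsub (by simpa)) (hsub (by simpa))
  · exact hdisj (f := -f) (by simpa) (hsub (by simpa)) (hsub (by simpa))

end PointEvaluations

section DualPlane

theorem surjective_pi_of_linearIndependent {ι k V : Type*} [Finite ι] [Field k] [AddCommGroup V]
    [Module k V] {L : ι → Module.Dual k V} (hL : LinearIndependent k L) :
    Function.Surjective (LinearMap.pi L) := by
  classical
  have := Fintype.ofFinite ι
  rw [← LinearMap.dualMap_injective_iff, injective_iff_map_eq_zero]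
  intro φ hφ
  have hsum : ∑ i, φ (Pi.single i 1) • L i = 0 := by
    ext v
    have hφv : φ (LinearMap.pi L v) = 0 := congrArg (· v) hφ
    rw [← Finset.univ_sum_single (LinearMap.pi L v), map_sum] at hφv
    have hcoord (i : ι) : φ (Pi.single i (L i v)) = φ (Pi.single i 1) * L i v := by
      rw [mul_comm, ← smul_eq_mul, ← map_smul, ← Pi.single_smul, smul_eq_mul, mul_one]
    simpa [hcoord] using hφv
  refine LinearMap.pi_ext' fun i ↦ LinearMap.ext_ring ?_
  simpa using Fintype.linearIndependent_iff.1 hL _ hsum i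

variable {X : Type*} [NormedAddCommGroup X] [NormedSpace ℝ X]

theorem exists_apply_eq_and_apply_eq {f g : StrongDual ℝ X} (hfg : LinearIndependent ℝ ![f, g])
    (a b : ℝ) : ∃ x, f x = a ∧ g x = b := by
  have hdual : LinearIndependent ℝ (ContinuousLinearMap.coeLM ℝ ∘ ![f, g]) :=
    hfg.map' _ (LinearMap.ker_eq_bot.2 ContinuousLinearMap.coe_injective)
  obtain ⟨x, hx⟩ := surjective_pi_of_linearIndependent hdual ![a, b]
  exact ⟨x, by simpa using congrFun hx 0, by simpa using congrFun hx 1⟩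

theorem eq_of_smul_eq_of_norm_eq {f g : StrongDual ℝ X} (hnorm : ‖f‖ = ‖g‖) {u : X}
    (hf : 0 < f u) (hg : 0 < g u) {c : ℝ} (hfg : c • f = g) : f = g := by
  have hc_pos : 0 < c := by
    rw [← hfg] at hg
    exact pos_of_mul_pos_left hg hf.le
  have hc : c = 1 := by
    have hf_ne : ‖f‖ ≠ 0 := norm_ne_zero_iff.2 fun h ↦ by simp [h] at hf
    rw [← hfg, norm_smul, Real.norm_of_nonneg hc_pos.le] at hnorm
    exact (right_eq_mul₀ hf_ne).1 hnorm
  rw [← hfg, hc, one_smul]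

theorem linearIndependent_pair_of_norm_eq {f g : StrongDual ℝ X} (hnorm : ‖f‖ = ‖g‖) {u : X}
    (hf : 0 < f u) (hg : 0 < g u) (hne : f ≠ g) : LinearIndependent ℝ ![f, g] :=
  (LinearIndependent.pair_iff' fun h ↦ by simp [h] at hf).2 fun _ hc ↦
    hne (eq_of_smul_eq_of_norm_eq hnorm hf hg hc)

/-- After a change of signs, the three functionals lie on the line `{f | f x = 1}` of the dual. -/
theorem eq_of_abs_apply_eq_one (hX : Module.finrank ℝ X = 2) {x u : X} {f : Fin 3 → StrongDual ℝ X}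
    (hf : ∀ i, f i ∈ unitBallExtremePoints (StrongDual ℝ X)) (hu : ∀ i, 0 < f i u)
    (hx : ∀ i, |f i x| = 1) : f 0 = f 1 ∨ f 1 = f 2 ∨ f 2 = f 0 := by
  have : FiniteDimensional ℝ X := Module.finite_of_finrank_eq_succ hX
  have : Nontrivial X := Module.nontrivial_of_finrank_eq_succ hX
  have hsign (i : Fin 3) : f i x = 1 ∨ f i x = -1 := (abs_eq zero_le_one).1 (hx i)
  have hext (i : Fin 3) : f i x • f i ∈ unitBallExtremePoints (StrongDual ℝ X) := by
    rcases hsign i with h | h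
    · simpa [h] using hf i
    · rw [h, show (-1 : ℝ) • f i = -f i by module]
      exact neg_mem_unitBallExtremePoints (hf i)
  have hline (i : Fin 3) : (f i x • f i) x = 1 := by
    rcases hsign i with h | h <;> simp [h]
  have hinj {i j : Fin 3} (hij : f i x • f i = f j x • f j) : f i = f j := by
    refine eq_of_smul_eq_of_norm_eq ?_ (hu i) (hu j) (c := f j x * f i x) ?_
    · rw [norm_eq_one_of_mem_unitBallExtremePoints (hf i),
        norm_eq_one_of_mem_unitBallExtremePoints (hf j)]
    · rw [mul_smul, hij, smul_smul, ← abs_mul_abs_self, hx, one_mul, one_smul]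
  have heval : (NormedSpace.inclusionInDoubleDual ℝ X x).toLinearMap ≠ 0 := by
    intro h
    have hzero : f 0 x = 0 := congrArg (· (f 0)) h
    simpa [hzero] using hx 0
  have hcollinear := (collinear_setOf_apply_eq ((finrank_strongDual X).trans hX) heval 1).subset
    (s₁ := {f 0 x • f 0, f 1 x • f 1, f 2 x • f 2}) (by
      rintro _ (rfl | rfl | rfl) <;> exact hline _)
  exact (eq_of_collinear_of_mem_extremePoints hcollinear (hext 0) (hext 1) (hext 2)).imp
    hinj (Or.imp hinj hinj)

theorem exists_apply_ne_zero_of_not_isGateauxSmooth (hX : Module.finrank ℝ X = 2)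
    (hsmooth : ¬ IsGateauxSmooth X) :
    ∃ u : X, ∀ e ∈ unitBallExtremePoints (StrongDual ℝ X), e u ≠ 0 := by
  have : FiniteDimensional ℝ X := Module.finite_of_finrank_eq_succ hX
  have : Nontrivial X := Module.nontrivial_of_finrank_eq_succ hX
  obtain ⟨x, hx, f, hf, g, hg, hne⟩ : ∃ x : X, x ≠ 0 ∧ (supportFunctionals x).Nontrivial := by
    simpa [isGateauxSmooth_iff] using hsmooth
  let φ := NormedSpace.inclusionInDoubleDualLi ℝ x
  have hφ : ‖φ‖ = ‖x‖ := LinearIsometry.norm_map _ x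
  have hφf : φ f ≠ 0 := hf.2.trans_ne (norm_ne_zero_iff.2 hx)
  have hφ_ne : φ ≠ 0 := fun h ↦ hφf (congrArg (· f) h)
  have hfg : LinearIndependent ℝ ![f, g] :=
    linearIndependent_pair_of_apply_eq (φ := φ.toLinearMap) hφf
      (hf.2.trans hg.2.symm) hne
  obtain ⟨u, hfu, hgu⟩ := exists_apply_eq_and_apply_eq hfg 1 (-1)
  refine ⟨u, fun e he heu ↦ ?_⟩
  obtain ⟨a, b, rfl⟩ := exists_eq_smul_add_smul ((finrank_strongDual X).trans hX) hfg e
  obtain rfl : a = b := by simpa [hfu, hgu, ← sub_eq_add_neg, sub_eq_zero] using heu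
  have hnotMem {c : ℝ} (hc : 0 < c) : c • f + c • g ∉ unitBallExtremePoints (StrongDual ℝ X) :=
    smul_add_smul_notMem_unitBallExtremePoints hφ_ne hf.1 hg.1 (hf.2.trans hφ.symm)
      (hg.2.trans hφ.symm) hne hc hc
  rcases lt_trichotomy a 0 with ha | rfl | ha
  · refine hnotMem (neg_pos.2 ha) ?_
    convert neg_mem_unitBallExtremePoints he using 1
    module
  · simpa using norm_eq_one_of_mem_unitBallExtremePoints he
  · exact hnotMem ha he

theorem exists_abs_apply_eq_norm_of_mem_halfSpace [FiniteDimensional ℝ X] (u x : X) :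
    ∃ e ∈ unitBallExtremePoints (StrongDual ℝ X), 0 ≤ e u ∧ |e x| = ‖x‖ := by
  obtain ⟨e, he, hex⟩ :=
    exists_mem_unitBallExtremePoints_apply_eq_norm (NormedSpace.inclusionInDoubleDualLi ℝ x)
  replace hex : e x = ‖x‖ := hex.trans (LinearIsometry.norm_map _ x)
  rcases le_total 0 (e u) with h | h
  · exact ⟨e, he, h, by simp [hex]⟩
  · exact ⟨-e, neg_mem_unitBallExtremePoints he, neg_nonneg.2 h, by simp [hex]⟩

end DualPlane

section Parametrization

variable {X : Type*} [NormedAddCommGroup X] [NormedSpace ℝ X]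

theorem exists_apply_eq_of_abs_apply_eq_one (hX : Module.finrank ℝ X = 2) {ι : Type*}
    {φ : ι → StrongDual ℝ X} (hφ : Function.Injective φ)
    (hext : ∀ i, φ i ∈ unitBallExtremePoints (StrongDual ℝ X)) {u : X} (hu : ∀ i, 0 < φ i u)
    (x : X) (h : ι → ℝ) : ∃ y, ∀ i, |φ i x| = 1 → φ i y = h i := by
  have : FiniteDimensional ℝ X := Module.finite_of_finrank_eq_succ hX
  have : Nontrivial X := Module.nontrivial_of_finrank_eq_succ hX
  have hnorm (i : ι) : ‖φ i‖ = 1 := norm_eq_one_of_mem_unitBallExtremePoints (hext i)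
  by_cases hpeak : ∃ i j, |φ i x| = 1 ∧ |φ j x| = 1 ∧ i ≠ j
  · obtain ⟨i, j, hi, hj, hij⟩ := hpeak
    obtain ⟨y, hyi, hyj⟩ := exists_apply_eq_and_apply_eq (linearIndependent_pair_of_norm_eq
      ((hnorm i).trans (hnorm j).symm) (hu i) (hu j) (hφ.ne hij)) (h i) (h j)
    refine ⟨y, fun k hk ↦ ?_⟩
    rcases eq_of_abs_apply_eq_one hX (f := φ ∘ ![i, j, k]) (x := x) (fun _ ↦ hext _)
      (fun _ ↦ hu _) (by simp [Fin.forall_fin_succ, hi, hj, hk]) with hfun | hfun | hfun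
    · exact absurd (hφ hfun) hij
    · obtain rfl : j = k := hφ hfun
      exact hyj
    · obtain rfl : k = i := hφ hfun
      exact hyi
  · push Not at hpeak
    by_cases hex : ∃ i, |φ i x| = 1
    · obtain ⟨i, hi⟩ := hex
      refine ⟨(h i / φ i x) • x, fun j hj ↦ ?_⟩
      obtain rfl := hpeak i j hi hj
      have hix : φ i x ≠ 0 := abs_ne_zero.1 (by simp [hi])
      simp [hix]
    · exact ⟨0, fun i hi ↦ absurd ⟨i, hi⟩ hex⟩

variable {K : Type*} [TopologicalSpace K] [CompactSpace K]

/-- The isometry `x ↦ (k ↦ φ k x)` defined by a continuous norming family `φ` in the dual unit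
ball. -/
noncomputable def evalIsometry (φ : C(K, StrongDual ℝ X)) (hφ : ∀ k, ‖φ k‖ ≤ 1)
    (hnorming : ∀ x, ∃ k, |φ k x| = ‖x‖) : X →ₗᵢ[ℝ] C(K, ℝ) where
  toFun x := ⟨fun k ↦ φ k x, by fun_prop⟩
  map_add' x y := by ext k; simp
  map_smul' c x := by ext k; simp
  norm_map' x := by
    refine le_antisymm ((ContinuousMap.norm_le _ (norm_nonneg x)).2 fun k ↦ ?_) ?_
    · simpa using (φ k).le_of_opNorm_le (hφ k) x
    · obtain ⟨k, hk⟩ := hnorming x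
      exact hk.ge.trans (ContinuousMap.norm_coe_le_norm ⟨fun k ↦ φ k x, by fun_prop⟩ k)

theorem exists_isUEmbedding_of_parametrization (hX : Module.finrank ℝ X = 2) {u : X}
    (hu : ∀ e ∈ unitBallExtremePoints (StrongDual ℝ X), e u ≠ 0) {φ : C(K, StrongDual ℝ X)}
    (hφ : Function.Injective φ)
    (hrange : range φ = unitBallExtremePoints (StrongDual ℝ X) ∩ {e | 0 ≤ e u}) :
    ∃ T : X →ₗᵢ[ℝ] C(K, ℝ), IsUEmbedding T := by
  have : FiniteDimensional ℝ X := Module.finite_of_finrank_eq_succ hX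
  have : Nontrivial X := Module.nontrivial_of_finrank_eq_succ hX
  have hmem (k : K) : φ k ∈ unitBallExtremePoints (StrongDual ℝ X) ∧ 0 ≤ φ k u :=
    hrange.subset (mem_range_self k)
  have hpos (k : K) : 0 < φ k u := (hmem k).2.lt_of_ne' (hu _ (hmem k).1)
  have hnorm (k : K) : ‖φ k‖ = 1 := norm_eq_one_of_mem_unitBallExtremePoints (hmem k).1
  have hnorming (x : X) : ∃ k, |φ k x| = ‖x‖ := by
    obtain ⟨e, he, heu, hex⟩ := exists_abs_apply_eq_norm_of_mem_halfSpace u x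
    obtain ⟨k, rfl⟩ := hrange.superset ⟨he, heu⟩
    exact ⟨k, hex⟩
  exact ⟨evalIsometry φ (fun k ↦ (hnorm k).le) hnorming, isUEmbedding_of_interpolation
    fun x _ h ↦ exists_apply_eq_of_abs_apply_eq_one hX hφ (fun k ↦ (hmem k).1) hpos x h⟩

end Parametrization

section Compactness

variable {X : Type*} [NormedAddCommGroup X] [NormedSpace ℝ X]

theorem isCompact_unitBallExtremePoints_inter_halfSpace (hX : Module.finrank ℝ X = 2) (u : X) :
    IsCompact (unitBallExtremePoints (StrongDual ℝ X) ∩ {e | 0 ≤ e u}) := by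
  have : FiniteDimensional ℝ X := Module.finite_of_finrank_eq_succ hX
  have hclosed := isClosed_unitBallExtremePoints ((finrank_strongDual X).trans hX)
  have hhalf : IsClosed {e : StrongDual ℝ X | 0 ≤ e u} :=
    isClosed_le continuous_const (NormedSpace.inclusionInDoubleDual ℝ X u).continuous
  exact ((isCompact_closedBall 0 1).of_isClosed_subset hclosed extremePoints_subset).inter_right
    hhalf

theorem exists_compactSpace_range_eq {E : Type u} [TopologicalSpace E] [T2Space E] [Small.{v} E]
    {S : Set E} (hS : IsCompact S) :
    ∃ (K : Type v) (_ : TopologicalSpace K) (_ : CompactSpace K) (_ : T2Space K) (φ : C(K, E)),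
      Function.Injective φ ∧ range φ = S := by
  have : CompactSpace S := isCompact_iff_compactSpace.1 hS
  let e := Shrink.homeomorph.{v} S
  refine ⟨Shrink.{v} S, inferInstance, e.compactSpace, e.t2Space,
    ⟨fun k ↦ e.symm k, by fun_prop⟩, Subtype.val_injective.comp e.symm.injective, ?_⟩
  exact (e.symm.surjective.range_comp Subtype.val).trans Subtype.range_val

end Compactness

theorem mainTheorem5 (X : Type u) [NormedAddCommGroup X] [NormedSpace ℝ X]
    (hX : Module.finrank ℝ X = 2) :
    (∃ (K : Type v) (_ : TopologicalSpace K) (_ : CompactSpace K) (_ : T2Space K)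
        (T : X →ₗᵢ[ℝ] C(K, ℝ)), IsUEmbedding T) ↔
      ¬ IsGateauxSmooth X := by
  constructor
  · rintro ⟨K, _, _, _, T, hT⟩ hsmooth
    exact not_isUEmbedding_of_isGateauxSmooth (by omega) hsmooth T hT
  · intro hsmooth
    have : FiniteDimensional ℝ X := Module.finite_of_finrank_eq_succ hX
    have : Small.{v} (StrongDual ℝ X) := Module.Finite.small.{v} ℝ _
    obtain ⟨u, hu⟩ := exists_apply_ne_zero_of_not_isGateauxSmooth hX hsmooth
    obtain ⟨K, _, hcompact, hT2, φ, hφ, hrange⟩ := exists_compactSpace_range_eq.{u, v}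
      (isCompact_unitBallExtremePoints_inter_halfSpace hX u)
    exact ⟨K, _, hcompact, hT2, exists_isUEmbedding_of_parametrization hX hu hφ hrange⟩
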